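/- Let $\overline E=(E,\|\cdot\|)$ be a Euclidean lattice of positive rank $n$; that is, $E$ is a free $\mathbb Z$-module of rank $n\geq 1$ and $\|\cdot\|$ is a Euclidean norm on $E_{\mathbb R}:=E\otimes\mathbb R$ (equivalently, $E$ is a discrete subgroup spanning an $n$-dimensional Euclidean vector space $E_{\mathbb R}$). Put $$h^0_\theta(\overline E):=\log\sum_{v\in E}e^{-\pi\|v\|^2},\qquad h^0_{\mathrm{Ar}}(\overline E):=\log\bigl|\{v\in E : \|v\|\leq 1\}\bigr|.$$ Then the sum converges, the set $\{v\in E:\|v\|\leq 1\}$ is finite, and $$-\pi\;\leq\; h^0_\theta(\overline E)-h^0_{\mathrm{Ar}}(\overline E)\;\leq\;\frac n2\log n+\log\left(\Bigl(1-\frac1{2\pi}\Bigr)^{-1}\right).$$ -/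

import Mathlib

/-- The theta invariant `log ∑_{v ∈ E} exp (-π ‖v‖²)` of the Euclidean lattice `(V, E, ‖·‖)`. -/
noncomputable def h0Theta {V : Type*} [NormedAddCommGroup V] [InnerProductSpace ℝ V]
    (E : Submodule ℤ V) : ℝ :=
  Real.log (∑' v : E, Real.exp (-Real.pi * ‖(v : V)‖ ^ 2))

/-- The Arakelov invariant `log |E ∩ B(0, 1)|` of the Euclidean lattice `(V, E, ‖·‖)`, where
`B(0, 1)` is the closed unit ball of `V`. -/
noncomputable def h0Ar {V : Type*} [NormedAddCommGroup V] [InnerProductSpace ℝ V]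
    (E : Submodule ℤ V) : ℝ :=
  Real.log ((((E : Set V) ∩ Metric.closedBall (0 : V) 1).ncard : ℕ) : ℝ)

open scoped ENNReal

/-! The lower bound holds because each lattice point of the unit ball contributes at least `exp
(-π)`. For the upper bound let `θ(t) = ∑ exp (-t ‖v‖²)`. Since `t ^ (n/2) θ(t)` is nondecreasing
(`tsum_gaussian_le_rpow_mul`), `θ(π) ≤ n ^ (n/2) θ(πn)`; its derivative being nonnegative, the
points outside the unit ball carry at most `n / (2t)` of `θ(t)` (`mul_tsum_gaussian_sub_sum_le`),
which is `1 / (2π)` at `t = πn`.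

Monotonicity is obtained without Poisson summation: a translated Gaussian sum is largest at the
origin (`latticeGaussSum_le_latticeGaussSum_zero`), and averaging this against a Gaussian in the
translation changes the parameter. -/

/-- The Gaussian sum `∑_{v ∈ E} exp (-a ‖v - y‖²)`, with values in `[0, ∞]`. -/
noncomputable def latticeGaussSum {V : Type*} [NormedAddCommGroup V]
    (E : Submodule ℤ V) (a : ℝ) (y : V) : ℝ≥0∞ :=
  ∑' v : E, ENNReal.ofReal (Real.exp (-a * ‖(v : V) - y‖ ^ 2))

/-! ### Products of Gaussian sums and classes modulo `2E` -/

/-- Multiplication by two on `E`. -/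
def doubling {V : Type*} [AddCommGroup V] (E : Submodule ℤ V) : E →ₗ[ℤ] E :=
  (2 : ℤ) • LinearMap.id

lemma doubling_apply {V : Type*} [AddCommGroup V] (E : Submodule ℤ V) (u : E) :
    doubling E u = u + u := by
  simp [doubling, two_smul]

/-- A representative in `E` of a class modulo `2E`. -/
noncomputable def repMod2 {V : Type*} [AddCommGroup V] (E : Submodule ℤ V)
    (c : E ⧸ LinearMap.range (doubling E)) : E :=
  Function.surjInv (Submodule.mkQ_surjective _) c

lemma mkQ_repMod2 {V : Type*} [AddCommGroup V] (E : Submodule ℤ V)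
    (c : E ⧸ LinearMap.range (doubling E)) :
    (LinearMap.range (doubling E)).mkQ (repMod2 E c) = c :=
  Function.surjInv_eq _ _

/-- Pairs `(v, w)` in `E` are parametrized by a common class modulo `2E` of `v + w` and `v - w`,
and the two elements of that class. -/
lemma bijective_pair_of_repMod2 {V : Type*} [AddCommGroup V] [Module ℝ V] (E : Submodule ℤ V) :
    Function.Bijective (fun x : (E ⧸ LinearMap.range (doubling E)) × E × E =>
      ((repMod2 E x.1 + x.2.1 + x.2.2, x.2.1 - x.2.2) : E × E)) := by
  have half : ∀ u v : E, u + u = v + v → u = v := by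
    intro u v h
    have h' : (u : V) + u = v + v := by exact_mod_cast congrArg Subtype.val h
    rw [← two_smul ℝ (u : V), ← two_smul ℝ (v : V)] at h'
    exact Subtype.ext (smul_right_injective V (two_ne_zero : (2 : ℝ) ≠ 0) h')
  constructor
  · rintro ⟨c, u, u'⟩ ⟨d, t, t'⟩ h
    simp only [Prod.mk.injEq] at h
    obtain ⟨h1, h2⟩ := h
    have h3 : repMod2 E c + doubling E u = repMod2 E d + doubling E t := by
      rw [doubling_apply, doubling_apply]
      calc repMod2 E c + (u + u) = (repMod2 E c + u + u') + (u - u') := by abel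
        _ = (repMod2 E d + t + t') + (t - t') := by rw [h1, h2]
        _ = _ := by abel
    have hq : ∀ z, (LinearMap.range (doubling E)).mkQ (doubling E z) = 0 := fun z => by
      simp
    have h4 : c = d := by
      have := congrArg (LinearMap.range (doubling E)).mkQ h3
      simpa only [map_add, hq, mkQ_repMod2, add_zero] using this
    subst h4
    have h5 : u = t := by
      apply half
      simpa only [doubling_apply] using add_left_cancel h3
    subst h5
    have h6 : u' = t' := by simpa using h2
    rw [h6]
  · rintro ⟨v, w⟩
    let c := (LinearMap.range (doubling E)).mkQ (v + w)
    have hc : (v + w) - repMod2 E c ∈ LinearMap.range (doubling E) := by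
      rw [← Submodule.Quotient.mk_eq_zero, ← Submodule.mkQ_apply, map_sub, mkQ_repMod2, sub_self]
    obtain ⟨u, hu⟩ := hc
    rw [doubling_apply] at hu
    refine ⟨(c, u, u - w), ?_⟩
    have : repMod2 E c + u + (u - w) = v := by
      calc repMod2 E c + u + (u - w) = repMod2 E c + (u + u) - w := by abel
        _ = v := by rw [hu]; abel
    simp [this]

/-- The sum of a Gaussian of half the parameter over a class modulo `2E`. -/
noncomputable def cosetGaussSum {V : Type*} [NormedAddCommGroup V]
    (E : Submodule ℤ V) (a : ℝ) (z : V) (c : E ⧸ LinearMap.range (doubling E)) : ℝ≥0∞ :=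
  ∑' u : E, ENNReal.ofReal
    (Real.exp (-(a / 2) * ‖((repMod2 E c : E) : V) + ((u : V) + u) - z‖ ^ 2))

/-- The parallelogram law separates the variables `v + w` and `v - w`, linked only by their common
class modulo `2E`. -/
lemma latticeGaussSum_mul_latticeGaussSum {V : Type*} [NormedAddCommGroup V] [InnerProductSpace ℝ V]
    (E : Submodule ℤ V) (a : ℝ) (x y : V) :
    latticeGaussSum E a x * latticeGaussSum E a y =
      ∑' c, cosetGaussSum E a (x + y) c * cosetGaussSum E a (x - y) c := by
  have hL : latticeGaussSum E a x * latticeGaussSum E a y =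
      ∑' p : E × E, ENNReal.ofReal (Real.exp (-a * ‖(p.1 : V) - x‖ ^ 2)) *
        ENNReal.ofReal (Real.exp (-a * ‖(p.2 : V) - y‖ ^ 2)) := by
    rw [ENNReal.tsum_prod']
    simp only [ENNReal.tsum_mul_left, ENNReal.tsum_mul_right]
    rfl
  have hR : ∑' c, cosetGaussSum E a (x + y) c * cosetGaussSum E a (x - y) c =
      ∑' q : (E ⧸ LinearMap.range (doubling E)) × E × E,
        ENNReal.ofReal (Real.exp
          (-(a / 2) * ‖((repMod2 E q.1 : E) : V) + ((q.2.1 : V) + q.2.1) - (x + y)‖ ^ 2)) *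
        ENNReal.ofReal (Real.exp
          (-(a / 2) * ‖((repMod2 E q.1 : E) : V) + ((q.2.2 : V) + q.2.2) - (x - y)‖ ^ 2)) := by
    rw [ENNReal.tsum_prod']
    refine tsum_congr fun c => ?_
    rw [ENNReal.tsum_prod']
    simp only [ENNReal.tsum_mul_left, ENNReal.tsum_mul_right]
    rfl
  rw [hL, hR, ← (Equiv.ofBijective _ (bijective_pair_of_repMod2 E)).tsum_eq]
  refine tsum_congr fun q => ?_
  obtain ⟨c, u, u'⟩ := q
  rw [← ENNReal.ofReal_mul (Real.exp_nonneg _), ← ENNReal.ofReal_mul (Real.exp_nonneg _),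
    ← Real.exp_add, ← Real.exp_add]
  congr 2
  simp only [Equiv.ofBijective_apply, Submodule.coe_add, Submodule.coe_sub]
  have key := parallelogram_law_with_norm ℝ
    ((repMod2 E c : V) + u + u' - x) ((u : V) - u' - y)
  have e1 : ((repMod2 E c : V) + u + u' - x) + ((u : V) - u' - y) =
      (repMod2 E c : V) + (u + u) - (x + y) := by abel
  have e2 : ((repMod2 E c : V) + u + u' - x) - ((u : V) - u' - y) =
      (repMod2 E c : V) + (u' + u') - (x - y) := by abel
  rw [e1, e2] at key
  linear_combination (a / 2) * key

lemma ENNReal.two_mul_mul_le_sq_add_sq (a b : ℝ≥0∞) : 2 * (a * b) ≤ a * a + b * b := by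
  induction a using ENNReal.recTopCoe with
  | top => simp
  | coe a =>
    induction b using ENNReal.recTopCoe with
    | top => simp
    | coe b =>
      norm_cast
      have := two_mul_le_add_sq a b
      rw [← sq, ← sq, ← mul_assoc]
      exact this

/-- All three products are sums over the same classes, of `A * B`, `A * A` and `B * B`, so `2AB ≤ A²
+ B²` applies termwise. -/
lemma two_mul_latticeGaussSum_sq_le {V : Type*} [NormedAddCommGroup V] [InnerProductSpace ℝ V]
    (E : Submodule ℤ V) (a : ℝ) (y : V) :
    2 * (latticeGaussSum E a y * latticeGaussSum E a y) ≤
      latticeGaussSum E a (y + y) * latticeGaussSum E a 0 + latticeGaussSum E a 0 * latticeGaussSum E a 0 := by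
  simp only [latticeGaussSum_mul_latticeGaussSum, add_zero, sub_zero, sub_self]
  rw [← ENNReal.tsum_mul_left, ← ENNReal.tsum_add]
  exact ENNReal.tsum_le_tsum fun c => ENNReal.two_mul_mul_le_sq_add_sq _ _

lemma latticeGaussSum_add_mem {V : Type*} [NormedAddCommGroup V]
    (E : Submodule ℤ V) (a : ℝ) (y : V) (e : E) :
    latticeGaussSum E a (y + e) = latticeGaussSum E a y := by
  unfold latticeGaussSum
  rw [← (Equiv.addRight e).tsum_eq]
  simp

/-! ### Convergence, and the maximum at the origin -/

section Lattice

variable {V : Type*} [NormedAddCommGroup V] [InnerProductSpace ℝ V] [FiniteDimensional ℝ V]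
  (E : Submodule ℤ V) [DiscreteTopology E]

lemma summable_gaussian {a : ℝ} (ha : 0 < a) :
    Summable (fun v : E => Real.exp (-a * ‖(v : V)‖ ^ 2)) := by
  -- Since `exp x ≥ x ^ k / k!`, terms decay like `‖v‖ ^ (-2k)`, with `2k` above the rank. The
  -- origin is set aside because `0⁻¹ = 0` breaks the bound there.
  let k := Module.finrank ℤ E + 1
  have hs := ((ZLattice.summable_norm_pow_inv E (2 * k) (by omega)).mul_left
    ((k.factorial : ℝ) * (a⁻¹) ^ k))
  refine Summable.of_norm_bounded_eventually hs ?_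
  have hfin : ({0} : Set E).Finite := Set.finite_singleton 0
  filter_upwards [hfin.compl_mem_cofinite] with v hv
  have hv0 : 0 < ‖(v : V)‖ := by
    rw [norm_pos_iff]
    intro h
    exact hv (by simpa using h)
  rw [Real.norm_of_nonneg (Real.exp_nonneg _), neg_mul, Real.exp_neg]
  have hx : 0 < a * ‖(v : V)‖ ^ 2 := by positivity
  have h1 := Real.pow_div_factorial_le_exp _ hx.le k
  have hp : 0 < (a * ‖(v : V)‖ ^ 2) ^ k / (k.factorial : ℝ) := by positivity
  refine (inv_anti₀ hp h1).trans (le_of_eq ?_)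
  simp only [Submodule.coe_norm]
  rw [inv_div, mul_pow, ← pow_mul, div_eq_mul_inv, mul_inv, inv_pow, inv_pow, mul_assoc]

lemma latticeGaussSum_zero {a : ℝ} (ha : 0 < a) :
    latticeGaussSum E a 0 = ENNReal.ofReal (∑' v : E, Real.exp (-a * ‖(v : V)‖ ^ 2)) := by
  rw [ENNReal.ofReal_tsum_of_nonneg (fun _ => Real.exp_nonneg _) (summable_gaussian E ha)]
  simp [latticeGaussSum]

lemma one_le_tsum_gaussian {a : ℝ} (ha : 0 < a) :
    1 ≤ ∑' v : E, Real.exp (-a * ‖(v : V)‖ ^ 2) := by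
  have := (summable_gaussian E ha).le_tsum 0 (fun _ _ => Real.exp_nonneg _)
  simpa using this

variable [IsZLattice ℝ E]

lemma exists_norm_sub_mem_le : ∃ C : ℝ, ∀ y : V, ∃ e : E, ‖y - e‖ ≤ C := by
  have := ZLattice.module_finite ℝ E
  have := ZLattice.module_free ℝ E
  let b := (Module.Free.chooseBasis ℤ E)
  let b' := b.ofZLatticeBasis ℝ E
  refine ⟨∑ i, ‖b' i‖, fun y => ⟨⟨ZSpan.floor b' y, ?_⟩, ?_⟩⟩
  · exact (b.ofZLatticeBasis_span ℝ E).le (ZSpan.floor b' y).2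
  · exact ZSpan.norm_fract_le b' y

/-- Periodicity reduces to `‖y‖ ≤ C`; then `‖v‖² ≤ 2‖v - y‖² + 2C²` costs half the parameter and a
factor `exp (a C²)`. -/
lemma exists_latticeGaussSum_le {a : ℝ} (ha : 0 < a) :
    ∃ B : ℝ≥0∞, B ≠ ∞ ∧ ∀ y : V, latticeGaussSum E a y ≤ B := by
  obtain ⟨C, hC⟩ := exists_norm_sub_mem_le E
  refine ⟨ENNReal.ofReal (Real.exp (a * C ^ 2)) * latticeGaussSum E (a / 2) 0, ?_, fun y => ?_⟩
  · rw [latticeGaussSum_zero E (by positivity)]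
    exact ENNReal.mul_ne_top ENNReal.ofReal_ne_top ENNReal.ofReal_ne_top
  · obtain ⟨e, he⟩ := hC y
    have h1 : latticeGaussSum E a y = latticeGaussSum E a (y - e) := by
      rw [← latticeGaussSum_add_mem E a (y - e) e, sub_add_cancel]
    rw [h1]
    unfold latticeGaussSum
    rw [← ENNReal.tsum_mul_left]
    refine ENNReal.tsum_le_tsum fun v => ?_
    rw [← ENNReal.ofReal_mul (Real.exp_nonneg _), ← Real.exp_add, sub_zero]
    refine ENNReal.ofReal_le_ofReal (Real.exp_le_exp.2 ?_)
    have h2 : ‖(v : V)‖ ≤ ‖(v : V) - (y - e)‖ + ‖y - (e : V)‖ := by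
      simpa using norm_add_le ((v : V) - (y - e)) (y - e)
    have h3 : ‖(v : V)‖ ^ 2 ≤ 2 * ‖(v : V) - (y - e)‖ ^ 2 + 2 * C ^ 2 := by
      have h4 : ‖(v : V)‖ ≤ ‖(v : V) - (y - e)‖ + C := by linarith
      have h5 := pow_le_pow_left₀ (norm_nonneg _) h4 2
      nlinarith [sq_nonneg (‖(v : V) - (y - e)‖ - C)]
    nlinarith [mul_le_mul_of_nonneg_left h3 ha.le]

/-- The Gaussian sum of a lattice is largest at the origin. -/
lemma latticeGaussSum_le_latticeGaussSum_zero {a : ℝ} (ha : 0 < a) (y : V) :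
    latticeGaussSum E a y ≤ latticeGaussSum E a 0 := by
  obtain ⟨B, hB, hbound⟩ := exists_latticeGaussSum_le E ha
  have hne : ∀ y, latticeGaussSum E a y ≠ ∞ := fun y => ne_top_of_le_ne_top hB (hbound y)
  set F : V → ℝ := fun y => (latticeGaussSum E a y).toReal with hF
  have hbdd : BddAbove (Set.range F) :=
    ⟨B.toReal, by rintro _ ⟨y, rfl⟩; exact ENNReal.toReal_mono hB (hbound y)⟩
  have hFnn : ∀ y, 0 ≤ F y := fun y => ENNReal.toReal_nonneg
  have hineq : ∀ y, 2 * (F y * F y) ≤ F (y + y) * F 0 + F 0 * F 0 := by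
    intro y
    have h := ENNReal.toReal_mono (ENNReal.add_ne_top.2
      ⟨ENNReal.mul_ne_top (hne _) (hne _), ENNReal.mul_ne_top (hne _) (hne _)⟩)
      (two_mul_latticeGaussSum_sq_le E a y)
    rw [ENNReal.toReal_add (ENNReal.mul_ne_top (hne _) (hne _))
      (ENNReal.mul_ne_top (hne _) (hne _))] at h
    simpa only [ENNReal.toReal_mul, ENNReal.toReal_ofNat] using h
  set M := ⨆ y, F y with hM
  have hle : ∀ y, F y ≤ M := fun y => le_ciSup hbdd y
  have hM0 : 0 ≤ M := (hFnn 0).trans (hle 0)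
  have hsup : M ≤ F 0 := by
    by_contra! hlt
    have hK : ∀ y, F y ≤ Real.sqrt ((M * F 0 + F 0 * F 0) / 2) := by
      intro y
      apply Real.le_sqrt_of_sq_le
      have := mul_le_mul_of_nonneg_right (hle (y + y)) (hFnn 0)
      nlinarith [hineq y]
    have hMK : M ≤ Real.sqrt ((M * F 0 + F 0 * F 0) / 2) := ciSup_le hK
    have hsq := (Real.le_sqrt' (lt_of_le_of_lt (hFnn 0) hlt)).1 hMK
    -- `2M² ≤ M F(0) + F(0)²` reads `(M - F(0)) (2M + F(0)) ≤ 0`.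
    nlinarith [hFnn 0]
  exact (ENNReal.toReal_le_toReal (hne y) (hne 0)).1 ((hle y).trans hsup)

end Lattice

/-! ### Averaging over translations, and monotonicity -/

/-- Completing the square in a product of two Gaussians. -/
lemma add_mul_norm_sub_sq {V : Type*} [NormedAddCommGroup V] [InnerProductSpace ℝ V]
    {a b : ℝ} (hab : a + b ≠ 0) (v y : V) :
    b * ‖y‖ ^ 2 + a * ‖v - y‖ ^ 2 =
      a * b / (a + b) * ‖v‖ ^ 2 + (a + b) * ‖y - (a / (a + b)) • v‖ ^ 2 := by
  rw [norm_sub_sq_real, norm_sub_sq_real, norm_smul, inner_smul_right, real_inner_comm v y,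
    mul_pow, Real.norm_eq_abs, sq_abs]
  field_simp
  ring

section Lattice

variable {V : Type*} [NormedAddCommGroup V] [InnerProductSpace ℝ V] [FiniteDimensional ℝ V]

lemma lintegral_gaussian_sub [MeasurableSpace V] [BorelSpace V] {k : ℝ} (hk : 0 < k) (z : V) :
    ∫⁻ y : V, ENNReal.ofReal (Real.exp (-k * ‖y - z‖ ^ 2)) =
      ENNReal.ofReal ((Real.pi / k) ^ (Module.finrank ℝ V / 2 : ℝ)) := by
  rw [MeasureTheory.lintegral_sub_right_eq_self
    (fun y : V => ENNReal.ofReal (Real.exp (-k * ‖y‖ ^ 2))) z]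
  have h := GaussianFourier.integral_rexp_neg_mul_sq_norm (V := V) hk
  rw [← h, MeasureTheory.ofReal_integral_eq_lintegral_ofReal]
  -- A non-integrable function has integral `0` by convention, so a positive value forces
  -- integrability.
  · apply MeasureTheory.Integrable.of_integral_ne_zero
    rw [h]
    exact (Real.rpow_pos_of_pos (by positivity) _).ne'
  · exact Filter.Eventually.of_forall fun _ => Real.exp_nonneg _

variable (E : Submodule ℤ V) [DiscreteTopology E]

lemma finite_norm_le (r : ℝ) : {v : E | ‖(v : V)‖ ≤ r}.Finite := by
  have h : ((E : Set V) ∩ Metric.closedBall (0 : V) r).Finite := by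
    rw [Set.inter_comm]
    exact Metric.finite_isBounded_inter_isClosed ⟨‹DiscreteTopology E›⟩ Metric.isBounded_closedBall
      (AddSubgroup.isClosed_of_discrete (H := E.toAddSubgroup))
  refine Set.Finite.of_finite_image (f := Subtype.val) (h.subset ?_)
    Subtype.val_injective.injOn
  rintro _ ⟨v, hv, rfl⟩
  exact ⟨v.2, by simpa using hv⟩

variable [IsZLattice ℝ E]

lemma mul_latticeGaussSum_le {a b : ℝ} (ha : 0 < a) (hb : 0 < b) :
    ENNReal.ofReal ((Real.pi / (a + b)) ^ (Module.finrank ℝ V / 2 : ℝ)) *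
        latticeGaussSum E (a * b / (a + b)) 0 ≤
      ENNReal.ofReal ((Real.pi / b) ^ (Module.finrank ℝ V / 2 : ℝ)) * latticeGaussSum E a 0 := by
  borelize V
  have hcount : Countable E := by
    have := ZLattice.module_finite ℝ E
    have := ZLattice.module_free ℝ E
    exact (Module.Free.chooseBasis ℤ E).equivFun.toEquiv.countable_iff.2 inferInstance
  calc _ = ∫⁻ y : V, ENNReal.ofReal (Real.exp (-b * ‖y‖ ^ 2)) * latticeGaussSum E a y := by
        simp only [latticeGaussSum, ← ENNReal.tsum_mul_left]
        rw [MeasureTheory.lintegral_tsum (fun v => by fun_prop)]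
        refine tsum_congr fun v => ?_
        rw [← lintegral_gaussian_sub (by positivity : 0 < a + b) ((a / (a + b)) • (v : V)),
          ← MeasureTheory.lintegral_mul_const' _ _ ENNReal.ofReal_ne_top]
        refine MeasureTheory.lintegral_congr fun y => ?_
        rw [← ENNReal.ofReal_mul (Real.exp_nonneg _), ← ENNReal.ofReal_mul (Real.exp_nonneg _),
          ← Real.exp_add, ← Real.exp_add, sub_zero]
        congr 2
        linear_combination add_mul_norm_sub_sq (by positivity : a + b ≠ 0) (v : V) y
    _ ≤ ∫⁻ y : V, ENNReal.ofReal (Real.exp (-b * ‖y‖ ^ 2)) * latticeGaussSum E a 0 :=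
        MeasureTheory.lintegral_mono fun y => by
          gcongr
          exact latticeGaussSum_le_latticeGaussSum_zero E ha y
    _ = _ := by
        rw [MeasureTheory.lintegral_mul_const _ (by fun_prop)]
        simpa using congrArg (· * latticeGaussSum E a 0) (lintegral_gaussian_sub hb (0 : V))

/-- `t ^ (n / 2) * ∑_{v ∈ E} exp (-t ‖v‖²)` is a nondecreasing function of `t > 0`. -/
lemma tsum_gaussian_le_rpow_mul {a c : ℝ} (hc : 0 < c) (hca : c ≤ a) :
    ∑' v : E, Real.exp (-c * ‖(v : V)‖ ^ 2) ≤
      (a / c) ^ (Module.finrank ℝ V / 2 : ℝ) * ∑' v : E, Real.exp (-a * ‖(v : V)‖ ^ 2) := by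
  have ha : 0 < a := hc.trans_le hca
  rcases hca.eq_or_lt with rfl | hlt
  · simp [div_self hc.ne']
  have hac : 0 < a - c := sub_pos.2 hlt
  -- Solves `ab / (a + b) = c`, so that averaging turns parameter `a` into `c`.
  set b := a * c / (a - c) with hb
  have hb0 : 0 < b := by positivity
  have h := mul_latticeGaussSum_le E ha hb0
  have h1 : a * b / (a + b) = c := by
    rw [hb]
    field_simp
    ring
  have h2 : (a + b) / b = a / c := by
    rw [hb]
    field_simp
    ring
  rw [h1, latticeGaussSum_zero E ha, latticeGaussSum_zero E hc,
    ← ENNReal.ofReal_mul (by positivity), ← ENNReal.ofReal_mul (by positivity),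
    ENNReal.ofReal_le_ofReal_iff (mul_nonneg (by positivity)
      (tsum_nonneg fun _ => Real.exp_nonneg _))] at h
  have hp : 0 < (Real.pi / (a + b)) ^ (Module.finrank ℝ V / 2 : ℝ) :=
    Real.rpow_pos_of_pos (by positivity) _
  have h3 : (Real.pi / b) ^ (Module.finrank ℝ V / 2 : ℝ) =
      (Real.pi / (a + b)) ^ (Module.finrank ℝ V / 2 : ℝ) *
        (a / c) ^ (Module.finrank ℝ V / 2 : ℝ) := by
    rw [← Real.mul_rpow (by positivity) (by positivity), ← h2]
    congr 1
    field_simp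
  rw [h3, mul_assoc] at h
  exact le_of_mul_le_mul_left h hp

/-! ### Tail estimate -/

/-- The part of a lattice Gaussian sum outside of any finite set containing the lattice points of
the unit ball is controlled by the whole sum. -/
lemma mul_tsum_gaussian_sub_sum_le {a : ℝ} (ha : 0 < a) (s : Finset E)
    (hs : ∀ v : E, v ∉ s → 1 ≤ ‖(v : V)‖) :
    a * (∑' v : E, Real.exp (-a * ‖(v : V)‖ ^ 2) - ∑ v ∈ s, Real.exp (-a * ‖(v : V)‖ ^ 2)) ≤
      Module.finrank ℝ V / 2 * ∑' v : E, Real.exp (-a * ‖(v : V)‖ ^ 2) := by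
  classical
  set θ := ∑' v : E, Real.exp (-a * ‖(v : V)‖ ^ 2) with hθ
  set d : ℝ := Module.finrank ℝ V / 2 with hd
  have hd0 : 0 ≤ d := by positivity
  set T := θ - ∑ v ∈ s, Real.exp (-a * ‖(v : V)‖ ^ 2) with hT
  have hsum := summable_gaussian E ha
  have hθ1 : 1 ≤ θ := one_le_tsum_gaussian E ha
  let g : E → ℝ := fun v => if v ∈ s then 0 else Real.exp (-a * ‖(v : V)‖ ^ 2)
  let k : E → ℝ := fun v => if v ∈ s then Real.exp (-a * ‖(v : V)‖ ^ 2) else 0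
  have hk : HasSum k (∑ v ∈ s, Real.exp (-a * ‖(v : V)‖ ^ 2)) := by
    have h : ∑ v ∈ s, Real.exp (-a * ‖(v : V)‖ ^ 2) = ∑ v ∈ s, k v :=
      Finset.sum_congr rfl fun v hv => by simp only [k, hv, if_true]
    rw [h]
    exact hasSum_sum_of_ne_finset_zero fun v hv => by simp [k, hv]
  have hg : HasSum g T := by
    have hgk : g = fun v : E => Real.exp (-a * ‖(v : V)‖ ^ 2) - k v := by
      funext v
      by_cases hv : v ∈ s <;> simp [g, k, hv]
    rw [hgk]
    exact hsum.hasSum.sub hk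
  -- A difference quotient replaces the derivative at `a`: `exp x ≥ 1 + x` with `x = (a - c) ‖v‖²`,
  -- which is at least `a - c` off `s`.
  have hstep : ∀ c, 0 < c → c < a → θ + (a - c) * T ≤ (a / c) ^ d * θ := by
    intro c hc hca
    refine le_trans ?_ (tsum_gaussian_le_rpow_mul E hc hca.le)
    refine hasSum_le (fun v => ?_) (hsum.hasSum.add (hg.mul_left (a - c)))
      (summable_gaussian E hc).hasSum
    have hx : (0 : ℝ) ≤ (a - c) * ‖(v : V)‖ ^ 2 := mul_nonneg (by linarith) (sq_nonneg _)
    have he : Real.exp (-c * ‖(v : V)‖ ^ 2) =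
        Real.exp (-a * ‖(v : V)‖ ^ 2) * Real.exp ((a - c) * ‖(v : V)‖ ^ 2) := by
      rw [← Real.exp_add]; ring_nf
    have h1 := Real.add_one_le_exp ((a - c) * ‖(v : V)‖ ^ 2)
    have hpos := Real.exp_pos (-a * ‖(v : V)‖ ^ 2)
    rw [he]
    by_cases hv : v ∈ s
    · simp only [g, hv, if_true, mul_zero, add_zero]
      nlinarith
    · simp only [g, hv, if_false]
      have h2 : (1 : ℝ) ≤ ‖(v : V)‖ ^ 2 := one_le_pow₀ (hs v hv)
      have h3 : (a - c) * 1 ≤ (a - c) * ‖(v : V)‖ ^ 2 :=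
        mul_le_mul_of_nonneg_left h2 (by linarith)
      nlinarith
  have hstep2 : ∀ c, 0 < c → c < a → (c - d * (a - c)) * T ≤ d * θ := by
    intro c hc hca
    have hT0 : 0 ≤ T := hg.nonneg fun v => by
      simp only [g]; split_ifs <;> positivity
    rcases le_or_gt (c - d * (a - c)) 0 with hneg | hpos
    · exact (mul_nonpos_of_nonpos_of_nonneg hneg hT0).trans (by positivity)
    have h1 := hstep c hc hca
    have hx : d * (a / c - 1) < 1 := by
      rw [← sub_pos]
      have : 1 - d * (a / c - 1) = (c - d * (a - c)) / c := by field_simp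
      rw [this]; positivity
    -- A rational bound, exact to first order at `c = a`, lets the factor `a - c` cancel before the
    -- limit.
    have hpow : (a / c) ^ d ≤ c / (c - d * (a - c)) := by
      rw [Real.rpow_def_of_pos (by positivity)]
      calc Real.exp (Real.log (a / c) * d) ≤ Real.exp (d * (a / c - 1)) := by
            rw [mul_comm]
            gcongr
            exact Real.log_le_sub_one_of_pos (by positivity)
        _ ≤ 1 / (1 - d * (a / c - 1)) := by
            rw [le_div_iff₀ (by linarith)]
            have := Real.one_sub_le_exp_neg (d * (a / c - 1))
            calc _ ≤ Real.exp (d * (a / c - 1)) * Real.exp (-(d * (a / c - 1))) := by gcongr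
              _ = 1 := by rw [← Real.exp_add]; simp
        _ = _ := by
            have : 1 - d * (a / c - 1) = (c - d * (a - c)) / c := by field_simp
            rw [this, one_div_div]
    have h2 : θ + (a - c) * T ≤ c / (c - d * (a - c)) * θ :=
      h1.trans (by gcongr)
    rw [div_mul_eq_mul_div, le_div_iff₀ hpos] at h2
    have h3 : (a - c) * ((c - d * (a - c)) * T) ≤ (a - c) * (d * θ) := by linarith
    exact le_of_mul_le_mul_left h3 (by linarith)
  have hlim : Filter.Tendsto (fun c => (c - d * (a - c)) * T) (nhdsWithin a (Set.Iio a))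
      (nhds (a * T)) := by
    have : Continuous fun c : ℝ => (c - d * (a - c)) * T := by fun_prop
    have h := this.tendsto a
    simp only [sub_self, mul_zero, sub_zero] at h
    exact h.mono_left nhdsWithin_le_nhds
  refine le_of_tendsto hlim ?_
  filter_upwards [Ioo_mem_nhdsLT ha] with c hc
  exact hstep2 c hc.1 hc.2

end Lattice

/-- A Euclidean lattice is a discrete subgroup `E` of a finite-dimensional real inner product
space `V` that spans `V` over `ℝ`. The first two conjuncts say that the quantities inside the
logarithms defining the two invariants are genuine. -/
theorem proposition4p1 {V : Type*} [NormedAddCommGroup V] [InnerProductSpace ℝ V]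
    [FiniteDimensional ℝ V] (E : Submodule ℤ V) [DiscreteTopology E] [IsZLattice ℝ E]
    (n : ℕ) (hn : 0 < n) (hrank : Module.finrank ℤ E = n) :
    Summable (fun v : E => Real.exp (-Real.pi * ‖(v : V)‖ ^ 2)) ∧
    ((E : Set V) ∩ Metric.closedBall (0 : V) 1).Finite ∧
    -Real.pi ≤ h0Theta E - h0Ar E ∧
    h0Theta E - h0Ar E ≤
      ((n : ℝ) / 2) * Real.log (n : ℝ) + Real.log (1 - 1 / (2 * Real.pi))⁻¹ := by
  have hpi := Real.pi_pos
  have hsum := summable_gaussian E hpi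
  set θ := ∑' v : E, Real.exp (-Real.pi * ‖(v : V)‖ ^ 2) with hθ
  have hθ1 : 1 ≤ θ := one_le_tsum_gaussian E hpi
  let s : Finset E := (finite_norm_le E 1).toFinset
  have hs : ∀ v : E, v ∈ s ↔ ‖(v : V)‖ ≤ 1 := fun v => by simp [s]
  have himage : (E : Set V) ∩ Metric.closedBall (0 : V) 1 = Subtype.val '' (s : Set E) := by
    ext v
    simp only [Set.mem_inter_iff, SetLike.mem_coe, mem_closedBall_zero_iff, Set.mem_image, hs]
    exact ⟨fun ⟨h1, h2⟩ => ⟨⟨v, h1⟩, h2, rfl⟩, by rintro ⟨w, hw, rfl⟩; exact ⟨w.2, hw⟩⟩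
  have hcard : ((E : Set V) ∩ Metric.closedBall (0 : V) 1).ncard = s.card := by
    rw [himage, Set.ncard_image_of_injective _ Subtype.val_injective, Set.ncard_coe_finset]
  have hN : (0 : ℝ) < s.card := by
    exact_mod_cast Finset.card_pos.2 ⟨0, (hs 0).2 (by simp)⟩
  have hn0 : (0 : ℝ) < n := by exact_mod_cast hn
  have hn1 : (1 : ℝ) ≤ n := by exact_mod_cast hn
  have hfin : (Module.finrank ℝ V : ℝ) = n := by rw [← ZLattice.rank ℝ E, hrank]
  refine ⟨hsum, himage ▸ s.finite_toSet.image _, ?_, ?_⟩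
  · rw [h0Theta, h0Ar, hcard, ← hθ, le_sub_iff_add_le, ← Real.log_exp (-Real.pi),
      ← Real.log_mul (Real.exp_ne_zero _) hN.ne']
    refine Real.log_le_log (by positivity) ?_
    calc Real.exp (-Real.pi) * s.card = ∑ v ∈ s, Real.exp (-Real.pi) := by
          rw [Finset.sum_const, nsmul_eq_mul, mul_comm]
      _ ≤ ∑ v ∈ s, Real.exp (-Real.pi * ‖(v : V)‖ ^ 2) := by
          refine Finset.sum_le_sum fun v hv => Real.exp_le_exp.2 ?_
          have : ‖(v : V)‖ ^ 2 ≤ 1 := pow_le_one₀ (norm_nonneg _) ((hs v).1 hv)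
          nlinarith
      _ ≤ θ := hsum.sum_le_tsum s fun _ _ => Real.exp_nonneg _
  -- At parameter `πn` the tail fraction `(n/2) / (πn) = 1 / (2π)` does not depend on `n`.
  · have ha : 0 < Real.pi * n := by positivity
    have h1 := tsum_gaussian_le_rpow_mul E hpi (le_mul_of_one_le_right hpi.le hn1)
    have h2 := mul_tsum_gaussian_sub_sum_le E ha s
      (fun v hv => (not_le.1 (mt (hs v).2 hv)).le)
    rw [hfin] at h1 h2
    set Θ := ∑' v : E, Real.exp (-(Real.pi * n) * ‖(v : V)‖ ^ 2) with hΘ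
    have h3 : ∑ v ∈ s, Real.exp (-(Real.pi * n) * ‖(v : V)‖ ^ 2) ≤ s.card := by
      calc _ ≤ ∑ v ∈ s, (1 : ℝ) := by
            refine Finset.sum_le_sum fun v _ => Real.exp_le_one_iff.2 ?_
            rw [neg_mul, neg_nonpos]
            positivity
        _ = s.card := by simp
    rw [mul_div_cancel_left₀ _ hpi.ne'] at h1
    have hq : 0 < 1 - 1 / (2 * Real.pi) := by
      rw [sub_pos, div_lt_one (by positivity)]
      linarith [Real.pi_gt_three]
    have h4 : (1 - 1 / (2 * Real.pi)) * Θ ≤ s.card := by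
      have h5 : Θ - s.card ≤ 1 / (2 * Real.pi) * Θ := by
        have h6 : Real.pi * n * (Θ - s.card) ≤ Real.pi * n * (1 / (2 * Real.pi) * Θ) := by
          calc _ ≤ Real.pi * n * (Θ - ∑ v ∈ s, Real.exp (-(Real.pi * n) * ‖(v : V)‖ ^ 2)) := by
                gcongr
            _ ≤ n / 2 * Θ := h2
            _ = _ := by field_simp
        exact le_of_mul_le_mul_left h6 ha
      linarith
    have h7 : θ ≤ (n : ℝ) ^ ((n : ℝ) / 2) * ((1 - 1 / (2 * Real.pi))⁻¹ * s.card) := by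
      refine h1.trans ?_
      gcongr
      rwa [inv_mul_eq_div, le_div_iff₀ hq, mul_comm]
    have hpow : 0 < (n : ℝ) ^ ((n : ℝ) / 2) := Real.rpow_pos_of_pos hn0 _
    have h8 := Real.log_le_log (by linarith) h7
    rw [Real.log_mul hpow.ne' (by positivity), Real.log_rpow hn0,
      Real.log_mul (inv_pos.2 hq).ne' hN.ne'] at h8
    rw [h0Theta, h0Ar, hcard, ← hθ]
    linarith
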